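/- Let $\mathcal V$ be a symmetric monoidal closed category whose underlying ordinary category is locally small, complete and cocomplete; "category", "functor" and "natural transformation" mean $\mathcal V$-category, $\mathcal V$-functor and $\mathcal V$-natural transformation. A category is *small* when its set of isomorphism classes of objects is small. A *weight* is a functor $\phi:\mathcal K^{op}\to\mathcal V$ with $\mathcal K$ small. For a functor $S:\mathcal K\to\mathcal A$, the *colimit* $\phi*S$ is an object $c$ of $\mathcal A$ with a natural transformation $\phi\to\mathcal A(S-,c)$ inducing for every $a\in\mathcal A$ an isomorphism $\mathcal A(c,a)\cong[\mathcal K^{op},\mathcal V](\phi,\mathcal A(S-,a))$ in $\mathcal V$; a functor $F:\mathcal A\to\mathcal B$ *preserves* it if $Fc$, with the composite $\phi\to\mathcal A(S-,c)\to\mathcal B(FS-,Fc)$, is the colimit $\phi*FS$. Let $\Phi$ be a class of weights. A functor *preserves $\Phi$-colimits* if it preserves each colimit $\phi*S$ with $\phi\in\Phi$ that exists in its domain. Let $\Phi^-$ be the class of all weights $\psi:\mathcal K^{op}\to\mathcal V$ such that $\Phi$-colimits commute with $\psi$-limits in $\mathcal V$, that is, such that the limit functor $\{\psi,-\}=[\mathcal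 K^{op},\mathcal V](\psi,-):[\mathcal K^{op},\mathcal V]\to\mathcal V$ preserves $\Phi$-colimits. For a category $\mathcal A$, let $\mathcal A_\Phi$ be the full subcategory of those $a\in\mathcal A$ (the *$\Phi$-atoms*) for which the representable $\mathcal A(a,-):\mathcal A\to\mathcal V$ preserves $\Phi$-colimits. **Proposition.** For any class $\Phi$ of weights and any category $\mathcal A$, the full subcategory $\mathcal A_\Phi$ is closed in $\mathcal A$ under any $\Phi^-$-colimits that exist in $\mathcal A$: if $\psi:\mathcal K^{op}\to\mathcal V$ lies in $\Phi^-$, if $S:\mathcal K\to\mathcal A$ takes its values in $\mathcal A_\Phi$, and if the colimit $\psi*S$ exists in $\mathcal A$, then $\psi*S$ lies in $\mathcal A_\Phi$. -/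

import Mathlib

open CategoryTheory MonoidalCategory Limits Opposite
open scoped CategoryTheory.MonoidalClosed

universe w v u u₁ u₂ u₃

noncomputable section

namespace VCat

section Mul
variable {V : Type u} [Category.{v} V] [MonoidalCategory V]
  {C : Type u₁} [EnrichedCategory V C]

/-- Composite `X ⊗ Y → C(a, b) ⊗ C(b, c) → C(a, c)` of two generalized elements of hom-objects. -/
def gcomp {X Y : V} {a b c : C} (f : X ⟶ (a ⟶[V] b)) (g : Y ⟶ (b ⟶[V] c)) :
    X ⊗ Y ⟶ (a ⟶[V] c) :=
  (f ⊗ₘ g) ≫ eComp V a b c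

lemma tensor_gcomp {X Y X' Y' : V} {a b c : C} (p : X' ⟶ X) (q : Y' ⟶ Y) (f : X ⟶ (a ⟶[V] b))
    (g : Y ⟶ (b ⟶[V] c)) : (p ⊗ₘ q) ≫ gcomp f g = gcomp (p ≫ f) (q ≫ g) := by
  simp [gcomp]

lemma whiskerRight_gcomp {X X' Y : V} {a b c : C} (p : X' ⟶ X) (f : X ⟶ (a ⟶[V] b))
    (g : Y ⟶ (b ⟶[V] c)) : p ▷ Y ≫ gcomp f g = gcomp (p ≫ f) g := by
  rw [← tensorHom_id, tensor_gcomp, Category.id_comp]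

lemma whiskerLeft_gcomp {X Y Y' : V} {a b c : C} (q : Y' ⟶ Y) (f : X ⟶ (a ⟶[V] b))
    (g : Y ⟶ (b ⟶[V] c)) : X ◁ q ≫ gcomp f g = gcomp f (q ≫ g) := by
  rw [← id_tensorHom, tensor_gcomp, Category.id_comp]

lemma gcomp_assoc {X Y Z : V} {a b c d : C} (f : X ⟶ (a ⟶[V] b)) (g : Y ⟶ (b ⟶[V] c))
    (h : Z ⟶ (c ⟶[V] d)) : gcomp (gcomp f g) h = (α_ X Y Z).hom ≫ gcomp f (gcomp g h) := by
  have e := e_assoc' V a b c d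
  have h1 : gcomp (gcomp f g) h = ((f ⊗ₘ g) ⊗ₘ h) ≫ eComp V a b c ▷ _ ≫ eComp V a c d := by
    rw [gcomp, gcomp, ← tensorHom_id, tensorHom_comp_tensorHom_assoc, Category.comp_id]
  have h2 : gcomp f (gcomp g h) = (f ⊗ₘ (g ⊗ₘ h)) ≫ _ ◁ eComp V b c d ≫ eComp V a b d := by
    rw [gcomp, gcomp, ← id_tensorHom, tensorHom_comp_tensorHom_assoc, Category.comp_id]
  rw [h1, h2, ← e, associator_naturality_assoc]

lemma eId_gcomp {Y : V} {a b : C} (g : Y ⟶ (a ⟶[V] b)) : gcomp (eId V a) g = (λ_ Y).hom ≫ g := by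
  have := e_id_comp V a b
  rw [Iso.inv_comp_eq, Category.comp_id] at this
  rw [gcomp, MonoidalCategory.tensorHom_def'_assoc, this]; simp

lemma gcomp_eId {Y : V} {a b : C} (g : Y ⟶ (a ⟶[V] b)) : gcomp g (eId V b) = (ρ_ Y).hom ≫ g := by
  have := e_comp_id V a b
  rw [Iso.inv_comp_eq, Category.comp_id] at this
  rw [gcomp, MonoidalCategory.tensorHom_def_assoc, this]; simp

lemma gcomp_map {D : Type u₂} [EnrichedCategory V D] (F : EnrichedFunctor V C D)
    {X Y : V} {a b c : C} (f : X ⟶ (a ⟶[V] b)) (g : Y ⟶ (b ⟶[V] c)) :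
    gcomp f g ≫ F.map a c = gcomp (f ≫ F.map a b) (g ≫ F.map b c) := by
  simp [gcomp]
section Whisker
variable {D : Type u₂} [EnrichedCategory V D]

/-- Postcomposition with `g : 𝟙_ V ⟶ D(x, y)`. -/
def postL (d : D) {x y : D} (g : 𝟙_ V ⟶ (x ⟶[V] y)) : (d ⟶[V] x) ⟶ (d ⟶[V] y) :=
  (ρ_ _).inv ≫ gcomp (𝟙 _) g

/-- Precomposition with `g : 𝟙_ V ⟶ D(x, y)`. -/
def preR {x y : D} (g : 𝟙_ V ⟶ (x ⟶[V] y)) (d : D) : (y ⟶[V] d) ⟶ (x ⟶[V] d) :=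
  (λ_ _).inv ≫ gcomp g (𝟙 _)

lemma comp_postL {X : V} {d x y : D} (f : X ⟶ (d ⟶[V] x)) (g : 𝟙_ V ⟶ (x ⟶[V] y)) :
    f ≫ postL d g = (ρ_ X).inv ≫ gcomp f g := by
  rw [postL, rightUnitor_inv_naturality_assoc, ← tensorHom_id, tensor_gcomp]; simp

lemma comp_preR {X : V} {d x y : D} (f : X ⟶ (y ⟶[V] d)) (g : 𝟙_ V ⟶ (x ⟶[V] y)) :
    f ≫ preR g d = (λ_ X).inv ≫ gcomp g f := by
  rw [preR, leftUnitor_inv_naturality_assoc, ← id_tensorHom, tensor_gcomp]; simp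

lemma gcomp_postL {X Y : V} {a d x y : D} (f : X ⟶ (a ⟶[V] d)) (h : Y ⟶ (d ⟶[V] x))
    (g : 𝟙_ V ⟶ (x ⟶[V] y)) : gcomp f (h ≫ postL d g) = gcomp f h ≫ postL a g := by
  rw [comp_postL, comp_postL, gcomp_assoc, rightUnitor_tensor_inv, Category.assoc,
    Iso.inv_hom_id_assoc, ← id_tensorHom, tensor_gcomp, Category.id_comp]

lemma gcomp_preR {X Y : V} {a d x y : D} (f : X ⟶ (y ⟶[V] d)) (h : Y ⟶ (d ⟶[V] a))
    (g : 𝟙_ V ⟶ (x ⟶[V] y)) : gcomp (f ≫ preR g d) h = gcomp f h ≫ preR g a := by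
  have := gcomp_assoc g f h
  rw [← Iso.inv_comp_eq] at this
  rw [comp_preR, comp_preR, ← this, leftUnitor_tensor_inv, Category.assoc,
    Iso.hom_inv_id_assoc, ← tensorHom_id, tensor_gcomp, Category.id_comp]

lemma gcomp_mid {X Y : V} {a d x y : D} (f : X ⟶ (a ⟶[V] x)) (h : Y ⟶ (y ⟶[V] d))
    (g : 𝟙_ V ⟶ (x ⟶[V] y)) : gcomp (f ≫ postL a g) h = gcomp f (h ≫ preR g d) := by
  rw [comp_postL, comp_preR]
  have h1 : gcomp ((ρ_ X).inv ≫ gcomp f g) h = (ρ_ X).inv ▷ Y ≫ gcomp (gcomp f g) h := by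
    rw [← tensorHom_id, tensor_gcomp, Category.id_comp]
  have h2 : gcomp f ((λ_ Y).inv ≫ gcomp g h) = X ◁ (λ_ Y).inv ≫ gcomp f (gcomp g h) := by
    rw [← id_tensorHom, tensor_gcomp, Category.id_comp]
  rw [h1, h2, gcomp_assoc]
  simp

lemma map_postL (F : EnrichedFunctor V C D) (d : C) {x y : C} (g : 𝟙_ V ⟶ (x ⟶[V] y)) :
    postL d g ≫ F.map d y = F.map d x ≫ postL (F.obj d) (g ≫ F.map x y) := by
  rw [comp_postL, postL, Category.assoc, gcomp_map, Category.id_comp]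

lemma map_preR (F : EnrichedFunctor V C D) (d : C) {x y : C} (g : 𝟙_ V ⟶ (x ⟶[V] y)) :
    preR g d ≫ F.map x d = F.map y d ≫ preR (g ≫ F.map x y) (F.obj d) := by
  rw [comp_preR, preR, Category.assoc, gcomp_map, Category.id_comp]

/-- `g` and `g'` are mutually inverse isomorphisms between `x` and `y`. -/
structure Inv {x y : D} (g : 𝟙_ V ⟶ (x ⟶[V] y)) (g' : 𝟙_ V ⟶ (y ⟶[V] x)) : Prop where
  hom_inv : (λ_ (𝟙_ V)).inv ≫ gcomp g g' = eId V x
  inv_hom : (λ_ (𝟙_ V)).inv ≫ gcomp g' g = eId V y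

lemma Inv.symm {x y : D} {g : 𝟙_ V ⟶ (x ⟶[V] y)} {g' : 𝟙_ V ⟶ (y ⟶[V] x)} (h : Inv g g') :
    Inv g' g := ⟨h.2, h.1⟩

lemma Inv.map {x y : C} {g : 𝟙_ V ⟶ (x ⟶[V] y)} {g' : 𝟙_ V ⟶ (y ⟶[V] x)} (h : Inv g g')
    (F : EnrichedFunctor V C D) : Inv (g ≫ F.map x y) (g' ≫ F.map y x) where
  hom_inv := by rw [← gcomp_map, ← Category.assoc, h.hom_inv, F.map_id]
  inv_hom := by rw [← gcomp_map, ← Category.assoc, h.inv_hom, F.map_id]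

lemma Inv.postL_postL {x y : D} {g : 𝟙_ V ⟶ (x ⟶[V] y)} {g' : 𝟙_ V ⟶ (y ⟶[V] x)} (h : Inv g g')
    (d : D) : postL d g ≫ postL d g' = 𝟙 _ := by
  rw [comp_postL, ← Category.id_comp (postL d g), gcomp_mid, comp_preR, h.hom_inv, gcomp_eId]
  simp

lemma Inv.preR_preR {x y : D} {g : 𝟙_ V ⟶ (x ⟶[V] y)} {g' : 𝟙_ V ⟶ (y ⟶[V] x)} (h : Inv g g')
    (d : D) : preR g d ≫ preR g' d = 𝟙 _ := by
  rw [comp_preR, ← Category.id_comp (preR g d), ← gcomp_mid, comp_postL,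
    ← unitors_inv_equal, h.inv_hom, eId_gcomp]
  simp

lemma postL_preR {a b x y : D} (g : 𝟙_ V ⟶ (x ⟶[V] y)) (k : 𝟙_ V ⟶ (a ⟶[V] b)) :
    postL b g ≫ preR k y = preR k x ≫ postL a g := by
  rw [comp_preR, ← Category.id_comp (postL b g), gcomp_postL, ← Category.assoc, preR]

lemma inv_of_iso {x y : C} (i : ForgetEnrichment.of V x ≅ ForgetEnrichment.of V y) :
    Inv (ForgetEnrichment.homTo V i.hom) (ForgetEnrichment.homTo V i.inv) where
  hom_inv := by
    have := ForgetEnrichment.homTo_comp V i.hom i.inv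
    rw [i.hom_inv_id, ForgetEnrichment.homTo_id, Category.assoc] at this
    exact this.symm
  inv_hom := by
    have := ForgetEnrichment.homTo_comp V i.inv i.hom
    rw [i.inv_hom_id, ForgetEnrichment.homTo_id, Category.assoc] at this
    exact this.symm

end Whisker

end Mul

section Nat
variable {V : Type u} [Category.{v} V] [MonoidalCategory V] [SymmetricCategory V]
  {C : Type u₁} [EnrichedCategory V C] {D : Type u₂} [EnrichedCategory V D]

/-- A `V`-natural family `X → D(F c, G c)`, indexed by the objects `c` of `C`, with vertex an
object `X` of `V`. For `X = 𝟙_ V` this is a `V`-natural transformation `F → G` (naturality is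
required with respect to the hom-objects `C(x, y)`, not merely with respect to the morphisms
`𝟙_ V ⟶ C(x, y)` of the underlying ordinary category). -/
@[ext]
structure NatFam (X : V) (F G : EnrichedFunctor V C D) where
  /-- The components of the family. -/
  app (c : C) : X ⟶ (F.obj c ⟶[V] G.obj c)
  nat (x y : C) :
    (β_ X (x ⟶[V] y)).hom ≫ gcomp (F.map x y) (app y) = gcomp (app x) (G.map x y)

namespace NatFam

/-- Precomposition of a `V`-natural family with a morphism of `V`. -/
def restrict {X Y : V} (f : Y ⟶ X) {F G : EnrichedFunctor V C D} (α : NatFam X F G) :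
    NatFam Y F G :=
  NatFam.mk (fun x => f ≫ α.app x) (fun x y => by
    have := α.nat x y
    calc _ = (f ⊗ₘ 𝟙 _) ≫ (β_ X (x ⟶[V] y)).hom ≫ gcomp (F.map x y) (α.app y) := by
          rw [BraidedCategory.braiding_naturality_assoc, tensor_gcomp, Category.id_comp]
      _ = _ := by rw [this, tensor_gcomp, Category.id_comp])

/-- The identity `V`-natural transformation. -/
def ident (F : EnrichedFunctor V C D) : NatFam (𝟙_ V) F F :=
  NatFam.mk (fun x => eId V (F.obj x)) (fun x y => by
    rw [eId_gcomp, gcomp_eId]; simp)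

/-- The composite of two `V`-natural families. -/
def comp {X Y : V} {F G H : EnrichedFunctor V C D} (α : NatFam X F G) (β : NatFam Y G H) :
    NatFam (X ⊗ Y) F H :=
  NatFam.mk (fun x => gcomp (α.app x) (β.app x)) (fun x y => by
    have h1 := gcomp_assoc (F.map x y) (α.app y) (β.app y)
    rw [← Iso.inv_comp_eq] at h1
    rw [← h1, BraidedCategory.braiding_tensor_left_hom]
    simp only [Category.assoc, Iso.hom_inv_id_assoc]
    have h2 : (β_ X (x ⟶[V] y)).hom ▷ Y ≫ gcomp (gcomp (F.map x y) (α.app y)) (β.app y) =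
        gcomp (gcomp (α.app x) (G.map x y)) (β.app y) := by
      rw [← α.nat, ← tensorHom_id, tensor_gcomp, Category.id_comp]
    rw [h2, gcomp_assoc, Iso.inv_hom_id_assoc]
    have h3 : X ◁ (β_ Y (x ⟶[V] y)).hom ≫ gcomp (α.app x) (gcomp (G.map x y) (β.app y)) =
        gcomp (α.app x) (gcomp (β.app x) (H.map x y)) := by
      rw [← β.nat, ← id_tensorHom, tensor_gcomp, Category.id_comp]
    rw [h3, gcomp_assoc])

lemma restrict_restrict {X Y Z : V} (g : Z ⟶ Y) (f : Y ⟶ X) {F G : EnrichedFunctor V C D}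
    (α : NatFam X F G) : (α.restrict f).restrict g = α.restrict (g ≫ f) := by
  ext; simp [restrict]

end NatFam

/-- The family `π` exhibits `E` as the object `∫_c D(F c, G c)` of `V`-natural transformations
from `F` to `G`: it is the universal `V`-natural family. -/
def IsNatHom {F G : EnrichedFunctor V C D} {E : V} (π : NatFam E F G) : Prop :=
  ∀ (X : V) (α : NatFam X F G), ∃! f : X ⟶ E, π.restrict f = α

/-- A `V`-category is small when its set of isomorphism classes of objects is small; here the small
sets are those of the universe which contains the hom-sets of the ordinary category `V`. -/
class IsSmallVCat (V : Type u) [Category.{v} V] [MonoidalCategory V]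
    (C : Type u₁) [EnrichedCategory V C] : Prop where
  small : Small.{v} (Quotient (isIsomorphicSetoid (ForgetEnrichment V C)))

section Ends

variable {F G : EnrichedFunctor V C D}

/-- Naturality of two components, in a form which only involves one hom-object of the source. -/
lemma transport {X : V} {x y : C} (g : 𝟙_ V ⟶ (x ⟶[V] y)) (a : X ⟶ (F.obj x ⟶[V] G.obj x))
    (b : X ⟶ (F.obj y ⟶[V] G.obj y))
    (h : (β_ X (x ⟶[V] y)).hom ≫ gcomp (F.map x y) b = gcomp a (G.map x y)) :
    a ≫ postL _ (g ≫ G.map x y) = b ≫ preR (g ≫ F.map x y) _ := by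
  rw [comp_postL, comp_preR]
  have h1 : gcomp a (g ≫ G.map x y) = X ◁ g ≫ gcomp a (G.map x y) := by
    rw [← id_tensorHom, tensor_gcomp, Category.id_comp]
  have h2 : gcomp (g ≫ F.map x y) b = g ▷ X ≫ gcomp (F.map x y) b := by
    rw [← tensorHom_id, tensor_gcomp, Category.id_comp]
  rw [h1, h2, ← h, BraidedCategory.braiding_naturality_right_assoc]
  simp

lemma transport' {X : V} {x y : C} {g : 𝟙_ V ⟶ (x ⟶[V] y)} {g' : 𝟙_ V ⟶ (y ⟶[V] x)}
    (hg : Inv g g') (a : X ⟶ (F.obj x ⟶[V] G.obj x))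
    (b : X ⟶ (F.obj y ⟶[V] G.obj y))
    (h : (β_ X (x ⟶[V] y)).hom ≫ gcomp (F.map x y) b = gcomp a (G.map x y)) :
    b = a ≫ postL _ (g ≫ G.map x y) ≫ preR (g' ≫ F.map y x) _ := by
  rw [← Category.assoc, transport g a b h, Category.assoc, (hg.map F).preR_preR,
    Category.comp_id]

/-- A `V`-natural family is determined by, and can be prescribed on, a family of objects which
meets every isomorphism class. -/
def extend {J : Type*} (r : J → C) (q : C → J)
    (e : ∀ c, 𝟙_ V ⟶ (r (q c) ⟶[V] c)) (e' : ∀ c, 𝟙_ V ⟶ (c ⟶[V] r (q c)))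
    (he : ∀ c, Inv (e c) (e' c)) {X : V} (a : ∀ j, X ⟶ (F.obj (r j) ⟶[V] G.obj (r j)))
    (ha : ∀ i j, (β_ X (r i ⟶[V] r j)).hom ≫ gcomp (F.map (r i) (r j)) (a j) =
      gcomp (a i) (G.map (r i) (r j))) : NatFam X F G where
  app c := a (q c) ≫ postL _ (e c ≫ G.map _ _) ≫ preR (e' c ≫ F.map _ _) _
  nat x y := by
    have hF : F.map x y ≫ postL _ (e' y ≫ F.map _ _) =
        (postL x (e' y) ≫ preR (e x) _ ≫ F.map (r (q x)) (r (q y))) ≫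
          preR (e' x ≫ F.map _ _) _ := by
      simp only [Category.assoc]
      rw [← map_postL, ← map_preR, ← Category.assoc (preR _ _), (he x).preR_preR,
        Category.id_comp]
    have hG : G.map x y ≫ preR (e x ≫ G.map _ _) _ =
        (postL x (e' y) ≫ preR (e x) _ ≫ G.map (r (q x)) (r (q y))) ≫
          postL _ (e y ≫ G.map _ _) := by
      rw [← Category.assoc (postL _ _), postL_preR]
      simp only [Category.assoc]
      rw [← map_preR, ← map_postL, ← Category.assoc (postL _ _), (he y).symm.postL_postL,
        Category.id_comp]
    rw [← Category.assoc (a _), ← gcomp_mid, hF, gcomp_postL, gcomp_preR,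
      ← Category.assoc (a _), gcomp_preR, gcomp_mid, hG, gcomp_postL]
    simp only [Category.assoc]
    rw [postL_preR]
    simp only [← Category.assoc]
    congr 2
    generalize postL x (e' y) ≫ preR (e x) _ = h
    have h1 : gcomp (h ≫ F.map (r (q x)) (r (q y))) (a (q y)) =
        h ▷ X ≫ gcomp (F.map (r (q x)) (r (q y))) (a (q y)) := by
      rw [← tensorHom_id, tensor_gcomp, Category.id_comp]
    have h2 : gcomp (a (q x)) (h ≫ G.map (r (q x)) (r (q y))) =
        X ◁ h ≫ gcomp (a (q x)) (G.map (r (q x)) (r (q y))) := by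
      rw [← id_tensorHom, tensor_gcomp, Category.id_comp]
    rw [h1, h2, ← ha, BraidedCategory.braiding_naturality_right_assoc]

/-- Objects of `V`-natural transformations exist when the domain is small. -/
theorem exists_isNatHom [HasLimits V] [MonoidalClosed V] [hC : IsSmallVCat V C]
    (F G : EnrichedFunctor V C D) : ∃ (E : V) (π : NatFam E F G), IsNatHom π := by
  have := hC.small
  let Q := Quotient (isIsomorphicSetoid (ForgetEnrichment V C))
  let J := Shrink.{v} Q
  let r : J → C := fun j => ForgetEnrichment.to V ((equivShrink Q).symm j).out
  let q : C → J := fun c => equivShrink Q (Quotient.mk _ (ForgetEnrichment.of V c))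
  have hi : ∀ c, Nonempty (ForgetEnrichment.of V (r (q c)) ≅ ForgetEnrichment.of V c) := by
    intro c
    have : Quotient.mk (isIsomorphicSetoid (ForgetEnrichment V C)) (ForgetEnrichment.of V (r (q c)))
      = Quotient.mk _ (ForgetEnrichment.of V c) := by
      simp [r, q]
    exact Quotient.exact this
  let i := fun c => (hi c).some
  have he : ∀ c, Inv (x := r (q c)) (y := c) (ForgetEnrichment.homTo V (i c).hom)
      (ForgetEnrichment.homTo V (i c).inv) := fun c => inv_of_iso (i c)
  let P : V := ∏ᶜ fun j : J => F.obj (r j) ⟶[V] G.obj (r j)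
  let R : V := ∏ᶜ fun p : J × J =>
    (ihom (r p.1 ⟶[V] r p.2)).obj (F.obj (r p.1) ⟶[V] G.obj (r p.2))
  let pr : ∀ j, P ⟶ (F.obj (r j) ⟶[V] G.obj (r j)) := fun j => Pi.π _ j
  let u : P ⟶ R := Pi.lift fun p => MonoidalClosed.curry (gcomp (F.map (r p.1) (r p.2)) (pr p.2))
  let w : P ⟶ R := Pi.lift fun p =>
    MonoidalClosed.curry ((β_ _ _).hom ≫ gcomp (pr p.1) (G.map (r p.1) (r p.2)))
  -- equalizing the two maps amounts to naturality
  have key : ∀ {X : V} (t : X ⟶ P), t ≫ u = t ≫ w ↔ ∀ i j,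
      (β_ X (r i ⟶[V] r j)).hom ≫ gcomp (F.map (r i) (r j)) (t ≫ pr j) =
        gcomp (t ≫ pr i) (G.map (r i) (r j)) := by
    intro X t
    have h0 : ∀ i j, (t ≫ u ≫ Pi.π _ (i, j) = t ≫ w ≫ Pi.π _ (i, j)) ↔
        (β_ X (r i ⟶[V] r j)).hom ≫ gcomp (F.map (r i) (r j)) (t ≫ pr j) =
        gcomp (t ≫ pr i) (G.map (r i) (r j)) := by
      intro i j
      have h1 : gcomp (F.map (r i) (r j)) (t ≫ pr j) =
          _ ◁ t ≫ gcomp (F.map (r i) (r j)) (pr j) := by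
        rw [← id_tensorHom, tensor_gcomp, Category.id_comp]
      have h2 : gcomp (t ≫ pr i) (G.map (r i) (r j)) =
          t ▷ _ ≫ gcomp (pr i) (G.map (r i) (r j)) := by
        rw [← tensorHom_id, tensor_gcomp, Category.id_comp]
      simp only [u, w, Pi.lift_π]
      rw [← MonoidalClosed.curry_natural_left, ← MonoidalClosed.curry_natural_left,
        MonoidalClosed.curry_injective.eq_iff, BraidedCategory.braiding_naturality_right_assoc,
        ← h1, ← h2, ← Iso.inv_comp_eq, ← SymmetricCategory.braiding_swap_eq_inv_braiding]
    constructor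
    · intro h i j
      rw [← h0, ← Category.assoc, h, Category.assoc]
    · intro h
      refine Pi.hom_ext _ _ fun p => ?_
      simpa using (h0 p.1 p.2).2 (h p.1 p.2)
  let E := equalizer u w
  let ι : E ⟶ P := equalizer.ι u w
  let π : NatFam E F G := extend r q _ _ he (fun j => ι ≫ pr j)
    ((key ι).1 (equalizer.condition u w))
  refine ⟨E, π, fun X α => ?_⟩
  have hl : ∀ j, Pi.lift (fun j => α.app (r j)) ≫ pr j = α.app (r j) := fun j => by simp [pr]
  refine ⟨equalizer.lift (Pi.lift fun j => α.app (r j))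
    ((key _).2 fun i j => by rw [hl, hl, α.nat]), ?_, ?_⟩
  · ext c
    simp only [NatFam.restrict, π, extend, ι, equalizer.lift_ι_assoc, Category.assoc]
    rw [← Category.assoc, hl]
    exact (transport' (he c) _ _ (α.nat _ _)).symm
  · intro f hf
    refine equalizer.hom_ext (Pi.hom_ext _ _ fun j => ?_)
    rw [equalizer.lift_ι]
    change (f ≫ ι) ≫ pr j = _ ≫ pr j
    rw [hl, Category.assoc, ← hf]
    change f ≫ ι ≫ pr j = f ≫ π.app (r j)
    congr 1
    exact transport' (he (r j)) _ _ ((key ι).1 (equalizer.condition u w) _ _)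

end Ends

end Nat

section FunctorCategory
variable {V : Type u} [Category.{v} V] [MonoidalCategory V] [SymmetricCategory V]
  [MonoidalClosed V] [HasLimits V]
  {C : Type u₁} [EnrichedCategory V C] [IsSmallVCat V C] {D : Type u₂} [EnrichedCategory V D]

/-- The hom-object `[C, D](F, G) = ∫_c D(F c, G c)` of the `V`-category `[C, D]`. -/
def natHom (F G : EnrichedFunctor V C D) : V := (exists_isNatHom F G).choose

/-- The universal `V`-natural family `[C, D](F, G) → D(F c, G c)`. -/
def natHomπ (F G : EnrichedFunctor V C D) : NatFam (natHom F G) F G :=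
  (exists_isNatHom F G).choose_spec.choose

lemma isNatHom_natHomπ (F G : EnrichedFunctor V C D) : IsNatHom (natHomπ F G) :=
  (exists_isNatHom F G).choose_spec.choose_spec

/-- The morphism into `[C, D](F, G)` induced by a `V`-natural family. -/
def natHomLift {F G : EnrichedFunctor V C D} {X : V} (α : NatFam X F G) : X ⟶ natHom F G :=
  (isNatHom_natHomπ F G X α).choose

@[simp]
lemma natHomLift_app {F G : EnrichedFunctor V C D} {X : V} (α : NatFam X F G) (c : C) :
    natHomLift α ≫ (natHomπ F G).app c = α.app c :=
  congrArg (fun β => NatFam.app β c) (isNatHom_natHomπ F G X α).choose_spec.1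

lemma natHom_ext {F G : EnrichedFunctor V C D} {X : V} {f g : X ⟶ natHom F G}
    (h : ∀ c, f ≫ (natHomπ F G).app c = g ≫ (natHomπ F G).app c) : f = g :=
  (isNatHom_natHomπ F G X ((natHomπ F G).restrict g)).unique (NatFam.ext (funext h)) rfl

/-- The `V`-category `[C, D]` of `V`-functors on a small `V`-category `C`. -/
instance functorVCategory : EnrichedCategory V (EnrichedFunctor V C D) where
  Hom F G := natHom F G
  id F := natHomLift (NatFam.ident F)
  comp F G H := natHomLift ((natHomπ F G).comp (natHomπ G H))
  id_comp F G := by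
    refine natHom_ext fun c => ?_
    simp only [Category.assoc, natHomLift_app, NatFam.comp, Category.id_comp]
    rw [← tensorHom_id, tensor_gcomp, natHomLift_app, Category.id_comp]
    simp [NatFam.ident, eId_gcomp]
  comp_id F G := by
    refine natHom_ext fun c => ?_
    simp only [Category.assoc, natHomLift_app, NatFam.comp, Category.id_comp]
    rw [← id_tensorHom, tensor_gcomp, natHomLift_app, Category.id_comp]
    simp [NatFam.ident, gcomp_eId]
  assoc F G H K := by
    refine natHom_ext fun c => ?_
    simp only [Category.assoc, natHomLift_app, NatFam.comp]
    rw [← tensorHom_id, ← id_tensorHom, tensor_gcomp, tensor_gcomp, natHomLift_app,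
      natHomLift_app, Category.id_comp, Category.id_comp]
    simp only
    rw [gcomp_assoc, Iso.inv_hom_id_assoc]

end FunctorCategory

section Representable
variable {V : Type u} [Category.{v} V] [MonoidalCategory V] [MonoidalClosed V]

/-- Currying, with values in the hom-objects of the `V`-category `V`. -/
def vcurry {X P Q : V} : (P ⊗ X ⟶ Q) ≃ (X ⟶ (EnrichedCategory.Hom P Q : V)) := (ihom.adjunction P).homEquiv X Q

lemma comp_vcurry {X Y P Q : V} (p : Y ⟶ X) (f : P ⊗ X ⟶ Q) :
    p ≫ vcurry f = vcurry (P ◁ p ≫ f) :=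
  (MonoidalClosed.curry_natural_left p f).symm

lemma eId_eq_vcurry (P : V) : eId V P = vcurry (ρ_ P).hom := rfl

lemma gcomp_vcurry {X Y P Q R : V} (f : P ⊗ X ⟶ Q) (g : Q ⊗ Y ⟶ R) :
    gcomp (vcurry f) (vcurry g) = vcurry ((α_ _ _ _).inv ≫ f ▷ Y ≫ g) := by
  have h : eComp V P Q R = vcurry (MonoidalClosed.compTranspose P Q R) := rfl
  rw [gcomp, h, comp_vcurry]
  congr 1
  have hf : P ◁ vcurry f ≫ (ihom.ev P).app Q = f := MonoidalClosed.uncurry_curry f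
  have hg : Q ◁ vcurry g ≫ (ihom.ev Q).app R = g := MonoidalClosed.uncurry_curry g
  have h1 : P ◁ (vcurry f ⊗ₘ vcurry g) ≫ (α_ P (EnrichedCategory.Hom P Q) (EnrichedCategory.Hom Q R)).inv =
      (α_ _ _ _).inv ≫ ((P ◁ vcurry f) ⊗ₘ vcurry g) := by
    rw [← id_tensorHom, associator_inv_naturality, id_tensorHom]
  rw [MonoidalClosed.compTranspose_eq]
  refine (reassoc_of% h1) _ |>.trans ?_
  congr 1
  change _ ≫ (ihom.ev P).app Q ▷ (EnrichedCategory.Hom Q R) ≫ _ = _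
  rw [MonoidalCategory.tensorHom_def, Category.assoc, whisker_exchange_assoc]
  refine (congrArg (fun t => (P ◁ vcurry f) ▷ Y ≫ (ihom.ev P).app Q ▷ Y ≫ t) hg).trans ?_
  rw [← comp_whiskerRight_assoc, hf]

/-- The evaluation `P ⊗ [P, Q] → Q`. -/
def vev (P Q : V) : P ⊗ (EnrichedCategory.Hom P Q : V) ⟶ Q := vcurry.symm (𝟙 _)

lemma vcurry_vev (P Q : V) : vcurry (vev P Q) = 𝟙 _ := by simp [vev]

lemma whiskerLeft_vcurry_vev {X P Q : V} (g : P ⊗ X ⟶ Q) : P ◁ vcurry g ≫ vev P Q = g := by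
  apply vcurry.injective
  rw [← comp_vcurry, vcurry_vev, Category.comp_id]

lemma eComp_eq_vcurry (P Q R : V) :
    eComp V P Q R = vcurry ((α_ _ _ _).inv ≫ vev P Q ▷ _ ≫ vev Q R) := by
  rw [← gcomp_vcurry, vcurry_vev, vcurry_vev]
  simp [gcomp]

variable {A : Type u₁} [EnrichedCategory V A]

/-- The representable `V`-functor `A(a, -) : A → V`. -/
def hom (a : A) : EnrichedFunctor V A V where
  obj b := a ⟶[V] b
  map b c := vcurry (eComp V a b c)
  map_id b := by
    rw [comp_vcurry, eId_eq_vcurry]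
    congr 1
    have := e_comp_id V a b
    rwa [Iso.inv_comp_eq, Category.comp_id] at this
  map_comp b c d := by
    change _ = gcomp _ _
    rw [gcomp_vcurry, comp_vcurry, e_assoc]

end Representable

section Op
variable {V : Type u} [Category.{v} V] [MonoidalCategory V] [SymmetricCategory V]
  {C : Type u₁} [EnrichedCategory V C] {D : Type u₂} [EnrichedCategory V D]

/-- The opposite `V`-functor. -/
def opFunctor (F : EnrichedFunctor V C D) : EnrichedFunctor V Cᵒᵖ Dᵒᵖ where
  obj x := op (F.obj x.unop)
  map x y := F.map y.unop x.unop
  map_id x := F.map_id x.unop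
  map_comp x y z := by
    rw [tensorHom_eComp_op_eq, eComp_op_eq, Category.assoc, F.map_comp]
    rfl

instance isSmallVCat_op [h : IsSmallVCat V C] : IsSmallVCat V Cᵒᵖ where
  small := by
    have := h.small
    let f : Quotient (isIsomorphicSetoid (ForgetEnrichment V Cᵒᵖ)) →
      Quotient (isIsomorphicSetoid (ForgetEnrichment V C)) :=
      Quotient.map (fun x => ForgetEnrichment.of V (ForgetEnrichment.to V x).unop) (by
        rintro x y ⟨i⟩
        exact ⟨((forgetEnrichmentOppositeEquivalence V C).functor.mapIso i).unop.symm⟩)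
    refine small_of_injective (f := f) ?_
    intro x y
    induction x using Quotient.inductionOn
    induction y using Quotient.inductionOn
    intro h
    obtain ⟨i⟩ := Quotient.exact h
    exact Quotient.sound ⟨(forgetEnrichmentOppositeEquivalence V C).inverse.mapIso i.symm.op⟩

end Op

section Weighted
variable {V : Type u} [Category.{v} V] [MonoidalCategory V] [SymmetricCategory V]
  [MonoidalClosed V]
  {K : Type w} [EnrichedCategory V K] {A : Type u₁} [EnrichedCategory V A]
  {B : Type u₂} [EnrichedCategory V B]

/-- The presheaf `A(S-, a) : Kᵒᵖ → V`. -/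
def homOver (S : EnrichedFunctor V K A) (a : A) : EnrichedFunctor V Kᵒᵖ V :=
  (opFunctor S).comp V (hom (op a))

/-- Precomposition `Z → [A(x, a), A(y, a)]` with a generalized element `s : Z → A(y, x)`. -/
def precomp {Z : V} {x y : A} (s : Z ⟶ (y ⟶[V] x)) (a : A) :
    Z ⟶ (EnrichedCategory.Hom (x ⟶[V] a) (y ⟶[V] a) : V) :=
  s ≫ vcurry ((β_ (x ⟶[V] a) (y ⟶[V] x)).hom ≫ eComp V y x a)

lemma precomp_eq {Z : V} {x y : A} (s : Z ⟶ (y ⟶[V] x)) (a : A) :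
    precomp s a = vcurry ((β_ (x ⟶[V] a) Z).hom ≫ gcomp s (𝟙 _)) := by
  rw [precomp, comp_vcurry, BraidedCategory.braiding_naturality_right_assoc, gcomp, tensorHom_id]

lemma precomp_exchange {Z : V} {x y : A} (s : Z ⟶ (y ⟶[V] x)) (c a : A) :
    (β_ (c ⟶[V] a) Z).hom ≫ gcomp (precomp s c) (vcurry (eComp V y c a)) =
      gcomp (vcurry (eComp V x c a)) (precomp s a) := by
  rw [precomp_eq, precomp_eq, gcomp_vcurry, gcomp_vcurry, comp_vcurry]
  congr 1
  have h1 : (gcomp s (𝟙 (x ⟶[V] c)) ▷ (c ⟶[V] a)) ≫ eComp V y c a =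
      gcomp (gcomp s (𝟙 _)) (𝟙 _) := by
    rw [← tensorHom_id]; rfl
  have h2 : Z ◁ eComp V x c a ≫ gcomp s (𝟙 (x ⟶[V] a)) =
      gcomp s (gcomp (𝟙 _) (𝟙 _)) := by
    rw [← id_tensorHom, tensor_gcomp]; simp [gcomp]
  rw [BraidedCategory.braiding_naturality_left_assoc, h2, comp_whiskerRight_assoc, h1,
    gcomp_assoc, BraidedCategory.braiding_tensor_left_hom]
  simp

lemma precomp_map (F : EnrichedFunctor V A B) {Z : V} {x y : A} (s : Z ⟶ (y ⟶[V] x)) (c : A) :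
    (β_ (𝟙_ V) Z).hom ≫ gcomp (precomp s c) (vcurry ((ρ_ _).hom ≫ F.map y c)) =
      gcomp (vcurry ((ρ_ _).hom ≫ F.map x c)) (precomp (s ≫ F.map y x) (F.obj c)) := by
  rw [precomp_eq, precomp_eq, gcomp_vcurry, gcomp_vcurry, comp_vcurry]
  congr 1
  have h1 : gcomp s (𝟙 (x ⟶[V] c)) ≫ F.map y c = gcomp (s ≫ F.map y x) (F.map x c) := by
    rw [gcomp_map, Category.id_comp]
  have h2 : Z ◁ F.map x c ≫ gcomp (s ≫ F.map y x) (𝟙 (F.obj x ⟶[V] F.obj c)) =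
      gcomp (s ≫ F.map y x) (F.map x c) := by
    rw [← id_tensorHom, tensor_gcomp]; simp
  rw [comp_whiskerRight_assoc, comp_whiskerRight_assoc,
    BraidedCategory.braiding_naturality_left_assoc, h2,
    rightUnitor_naturality_assoc, h1]
  rw [rightUnitor_naturality_assoc, braiding_tensorUnit_left, rightUnitor_tensor_hom_assoc,
    Iso.inv_hom_id_assoc]
  rw [← MonoidalCategory.whiskerLeft_comp_assoc, Category.assoc, Iso.inv_hom_id,
    Category.comp_id, triangle_assoc_comp_right_assoc]


/-- The action `A(c, a) → [A(S k, c), A(S k, a)]` of the functors `A(S k, -)`, as a `V`-natural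
family in `k`. -/
def push (S : EnrichedFunctor V K A) (c a : A) :
    NatFam (c ⟶[V] a) (homOver S c) (homOver S a) where
  app k := (hom (S.obj k.unop)).map c a
  nat x y := precomp_exchange (S.map y.unop x.unop) c a

/-- The `V`-natural family `A(c, a) → [φ k, A(S k, a)]` induced by `μ : φ → A(S-, c)`. -/
def cocomparison {φ : EnrichedFunctor V Kᵒᵖ V} {S : EnrichedFunctor V K A} {c : A}
    (μ : NatFam (𝟙_ V) φ (homOver S c)) (a : A) : NatFam (c ⟶[V] a) φ (homOver S a) :=
  (μ.comp (push S c a)).restrict (λ_ _).inv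

/-- The `V`-natural transformation `μ : φ → A(S-, c)` exhibits `c` as the colimit `φ * S`: for each
`a`, the induced map `A(c, a) → [Kᵒᵖ, V](φ, A(S-, a))` is an isomorphism, that is, `A(c, a)` is
itself the object of `V`-natural transformations from `φ` to `A(S-, a)`. -/
def IsWeightedColimit (φ : EnrichedFunctor V Kᵒᵖ V) (S : EnrichedFunctor V K A) (c : A)
    (μ : NatFam (𝟙_ V) φ (homOver S c)) : Prop :=
  ∀ a : A, IsNatHom (cocomparison μ a)

/-- The `V`-natural transformation `A(S-, c) → B(F S-, F c)` given by the action of `F`. -/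
def mapHom (F : EnrichedFunctor V A B) (S : EnrichedFunctor V K A) (c : A) :
    NatFam (𝟙_ V) (homOver S c) (homOver (S.comp V F) (F.obj c)) where
  app k := vcurry ((ρ_ _).hom ≫ F.map (S.obj k.unop) c)
  nat x y := precomp_map F (S.map y.unop x.unop) c

/-- The composite `φ → A(S-, c) → B(F S-, F c)` of `μ` with the action of `F`. -/
def mapCocone (F : EnrichedFunctor V A B) {φ : EnrichedFunctor V Kᵒᵖ V}
    {S : EnrichedFunctor V K A} {c : A} (μ : NatFam (𝟙_ V) φ (homOver S c)) :
    NatFam (𝟙_ V) φ (homOver (S.comp V F) (F.obj c)) :=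
  (μ.comp (mapHom F S c)).restrict (λ_ _).inv

/-- `F` preserves every `φ`-weighted colimit which exists in `A`. -/
def PreservesWeightedColimits (φ : EnrichedFunctor V Kᵒᵖ V) (F : EnrichedFunctor V A B) : Prop :=
  ∀ (S : EnrichedFunctor V K A) (c : A) (μ : NatFam (𝟙_ V) φ (homOver S c)),
    IsWeightedColimit φ S c μ → IsWeightedColimit φ (S.comp V F) (F.obj c) (mapCocone F μ)

end Weighted

section WeightedLimits
variable {V : Type u} [Category.{v} V] [MonoidalCategory V] [SymmetricCategory V]
  [MonoidalClosed V]
  {J : Type w} [EnrichedCategory V J] {A : Type u₁} [EnrichedCategory V A]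

/-- The `V`-natural family `A(a, c) → [A(c, T j), A(a, T j)]` given by precomposition. -/
def pull (T : EnrichedFunctor V J A) (c a : A) :
    NatFam (a ⟶[V] c) (T.comp V (hom c)) (T.comp V (hom a)) where
  app j := precomp (𝟙 _) (T.obj j)
  nat x y := by
    have h := precomp_exchange (𝟙 (a ⟶[V] c)) (T.obj x) (T.obj y)
    have h' : (β_ (a ⟶[V] c) (T.obj x ⟶[V] T.obj y)).hom ≫
        gcomp (vcurry (eComp V c (T.obj x) (T.obj y))) (precomp (𝟙 _) (T.obj y)) =
        gcomp (precomp (𝟙 _) (T.obj x)) (vcurry (eComp V a (T.obj x) (T.obj y))) := by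
      rw [← h, SymmetricCategory.symmetry_assoc]
    change (β_ (a ⟶[V] c) (x ⟶[V] y)).hom ≫
        gcomp (T.map x y ≫ vcurry (eComp V c (T.obj x) (T.obj y))) (precomp (𝟙 _) (T.obj y)) =
      gcomp (precomp (𝟙 _) (T.obj x)) (T.map x y ≫ vcurry (eComp V a (T.obj x) (T.obj y)))
    rw [← whiskerRight_gcomp, ← whiskerLeft_gcomp, ← h',
      BraidedCategory.braiding_naturality_right_assoc]

/-- The `V`-natural family `A(a, c) → [φ j, A(a, T j)]` induced by `μ : φ → A(c, T-)`. -/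
def coneComparison {φ : EnrichedFunctor V J V} {T : EnrichedFunctor V J A} {c : A}
    (μ : NatFam (𝟙_ V) φ (T.comp V (hom c))) (a : A) :
    NatFam (a ⟶[V] c) φ (T.comp V (hom a)) :=
  (μ.comp (pull T c a)).restrict (λ_ _).inv

/-- The `V`-natural transformation `μ : φ → A(c, T-)` exhibits `c` as the limit `{φ, T}`: for each
`a`, the induced map `A(a, c) → [J, V](φ, A(a, T-))` is an isomorphism. -/
def IsWeightedLimit (φ : EnrichedFunctor V J V) (T : EnrichedFunctor V J A) (c : A)
    (μ : NatFam (𝟙_ V) φ (T.comp V (hom c))) : Prop :=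
  ∀ a : A, IsNatHom (coneComparison μ a)

/-- The family `X → [[X, Q], Q]` of evaluations. -/
def evAt (X Q : V) : X ⟶ (EnrichedCategory.Hom (EnrichedCategory.Hom X Q : V) Q : V) :=
  vcurry ((β_ _ _).hom ≫ vev X Q)

lemma gcomp_evAt {X Y P Q : V} (g : X ⊗ (P ⊗ Y) ⟶ Q) :
    gcomp (vcurry (vcurry g)) (evAt X Q) =
      vcurry ((α_ P Y X).inv ≫ (β_ (P ⊗ Y) X).hom ≫ g) := by
  rw [evAt, gcomp_vcurry, BraidedCategory.braiding_naturality_left_assoc, whiskerLeft_vcurry_vev]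

lemma gcomp_evAt_bijective (X Y P Q : V) : Function.Bijective
    (fun f : Y ⟶ (EnrichedCategory.Hom P (EnrichedCategory.Hom X Q : V) : V) =>
      gcomp f (evAt X Q)) := by
  constructor
  · intro f f' h
    obtain ⟨f, rfl⟩ := vcurry.surjective f
    obtain ⟨f, rfl⟩ := vcurry.surjective f
    obtain ⟨f', rfl⟩ := vcurry.surjective f'
    obtain ⟨f', rfl⟩ := vcurry.surjective f'
    simp only [gcomp_evAt] at h
    have := vcurry.injective h
    rw [cancel_epi, cancel_epi] at this
    rw [this]
  · intro t
    obtain ⟨t, rfl⟩ := vcurry.surjective t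
    refine ⟨vcurry (vcurry ((β_ X (P ⊗ Y)).hom ≫ (α_ _ _ _).hom ≫ t)), ?_⟩
    simp only [gcomp_evAt]
    rw [SymmetricCategory.symmetry_assoc, Iso.inv_hom_id_assoc]

lemma precomp_evAt (X E Q : V) :
    gcomp (precomp (𝟙 (EnrichedCategory.Hom X E : V)) Q) (evAt X Q) =
      ((β_ _ _).hom ≫ vev X E) ≫ evAt E Q := by
  have h : gcomp (𝟙 (EnrichedCategory.Hom X E : V)) (𝟙 (EnrichedCategory.Hom E Q : V)) =
      eComp V X E Q := by simp [gcomp]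
  rw [precomp_eq, h, eComp_eq_vcurry, comp_vcurry, gcomp_evAt, evAt, comp_vcurry,
    BraidedCategory.braiding_naturality_right_assoc]
  congr 1
  rw [comp_whiskerRight_assoc, ← BraidedCategory.braiding_naturality_left_assoc,
    BraidedCategory.braiding_tensor_left_hom, BraidedCategory.braiding_tensor_right_hom]
  simp

lemma evAt_nat (X : V) {Q R : V} :
    (β_ X (EnrichedCategory.Hom Q R : V)).hom ≫ gcomp (vcurry (eComp V X Q R)) (evAt X R) =
      gcomp (evAt X Q) (𝟙 (EnrichedCategory.Hom Q R : V)) := by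
  rw [eComp_eq_vcurry, gcomp_evAt, comp_vcurry, ← vcurry_vev Q R, evAt, gcomp_vcurry]
  congr 1
  rw [comp_whiskerRight_assoc, BraidedCategory.braiding_tensor_left_hom]
  simp only [Category.assoc, Iso.hom_inv_id_assoc, Iso.inv_hom_id_assoc]
  rw [← MonoidalCategory.whiskerLeft_comp_assoc, SymmetricCategory.symmetry]
  simp

lemma evAt_nat' (X : V) {Z Q R : V} (t : Z ⟶ (EnrichedCategory.Hom Q R : V)) :
    (β_ X Z).hom ≫ gcomp (t ≫ vcurry (eComp V X Q R)) (evAt X R) = gcomp (evAt X Q) t := by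
  rw [← whiskerRight_gcomp, ← BraidedCategory.braiding_naturality_right_assoc, evAt_nat,
    whiskerLeft_gcomp, Category.comp_id]

lemma lift_nat_aux {X Y Z P P' Q R : V} (p : Z ⟶ (EnrichedCategory.Hom P P' : V))
    (t : Z ⟶ (EnrichedCategory.Hom Q R : V))
    (a : Y ⟶ (EnrichedCategory.Hom P (EnrichedCategory.Hom X Q : V) : V))
    (a' : Y ⟶ (EnrichedCategory.Hom P' (EnrichedCategory.Hom X R : V) : V))
    (h : (β_ (Y ⊗ X) Z).hom ≫ gcomp p (gcomp a' (evAt X R)) = gcomp (gcomp a (evAt X Q)) t) :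
    gcomp ((β_ Y Z).hom ≫ gcomp p a') (evAt X R) =
      gcomp (gcomp a (t ≫ vcurry (eComp V X Q R))) (evAt X R) := by
  have e : gcomp (t ≫ vcurry (eComp V X Q R)) (evAt X R) =
      (β_ Z X).hom ≫ gcomp (evAt X Q) t := by
    rw [← evAt_nat', SymmetricCategory.symmetry_assoc]
  have h3 : gcomp a (gcomp (evAt X Q) t) = (α_ _ _ _).inv ≫ gcomp (gcomp a (evAt X Q)) t := by
    rw [gcomp_assoc, Iso.inv_hom_id_assoc]
  rw [← whiskerRight_gcomp, gcomp_assoc, gcomp_assoc, e, ← whiskerLeft_gcomp, h3, ← h,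
    BraidedCategory.braiding_tensor_left_hom]
  simp only [Category.assoc, Iso.inv_hom_id_assoc]
  rw [← MonoidalCategory.whiskerLeft_comp_assoc, SymmetricCategory.symmetry]
  simp

lemma key_aux {X Y P Q E : V} (f : Y ⟶ (EnrichedCategory.Hom X E : V))
    (m : 𝟙_ V ⟶ (EnrichedCategory.Hom P (EnrichedCategory.Hom E Q : V) : V))
    (p : E ⟶ (EnrichedCategory.Hom P Q : V)) (hm : gcomp m (evAt E Q) = (λ_ _).hom ≫ p) :
    gcomp (f ≫ (λ_ _).inv ≫ gcomp m (precomp (𝟙 _) Q)) (evAt X Q) =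
      (f ▷ X ≫ (β_ _ _).hom ≫ vev X E) ≫ p := by
  rw [← whiskerRight_gcomp, ← whiskerRight_gcomp, gcomp_assoc, precomp_evAt,
    ← whiskerLeft_gcomp, hm]
  simp

/-- The evaluations as a `V`-natural family. -/
def evFam (F : EnrichedFunctor V J V) (X : V) : NatFam X (F.comp V (hom X)) F where
  app j := evAt X (F.obj j)
  nat x y := evAt_nat' X (F.map x y)

lemma comp_evFam_bijective (ψ F : EnrichedFunctor V J V) (X Y : V) :
    Function.Bijective (fun α : NatFam Y ψ (F.comp V (hom X)) => α.comp (evFam F X)) := by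
  constructor
  · intro α β h
    ext j
    exact (gcomp_evAt_bijective _ _ _ _).1 (congrArg (fun γ => NatFam.app γ j) h)
  · intro γ
    choose a ha using fun j => (gcomp_evAt_bijective X Y (ψ.obj j) (F.obj j)).2 (γ.app j)
    refine ⟨⟨a, fun x y => ?_⟩, NatFam.ext (funext ha)⟩
    apply (gcomp_evAt_bijective _ _ _ _).1
    refine lift_nat_aux (ψ.map x y) (F.map x y) (a x) (a y) ?_
    rw [show gcomp (a y) (evAt X (F.obj y)) = γ.app y from ha y,
      show gcomp (a x) (evAt X (F.obj x)) = γ.app x from ha x, γ.nat]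

lemma comp_vev_bijective (X Y E : V) : Function.Bijective
    (fun f : Y ⟶ (EnrichedCategory.Hom X E : V) => f ▷ X ≫ (β_ _ _).hom ≫ vev X E) := by
  have h : ∀ g : X ⊗ Y ⟶ E, vcurry g ▷ X ≫ (β_ _ _).hom ≫ vev X E = (β_ _ _).hom ≫ g := by
    intro g
    rw [BraidedCategory.braiding_naturality_left_assoc, whiskerLeft_vcurry_vev]
  constructor
  · intro f f' hf
    obtain ⟨f, rfl⟩ := vcurry.surjective f
    obtain ⟨f', rfl⟩ := vcurry.surjective f'
    simp only [h, cancel_epi] at hf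
    rw [hf]
  · intro t
    refine ⟨vcurry ((β_ _ _).hom ≫ t), ?_⟩
    simp only [h]
    rw [SymmetricCategory.symmetry_assoc]

variable [HasLimits V] [IsSmallVCat V J]

/-- The hom-object `[J, V](ψ, F)` is the limit of `F` weighted by `ψ`. -/
theorem isWeightedLimit_natHom (ψ F : EnrichedFunctor V J V) :
    ∃ μ, IsWeightedLimit ψ F (natHom ψ F) μ := by
  obtain ⟨μ, hμ⟩ := (comp_evFam_bijective ψ F (natHom ψ F) (𝟙_ V)).2
    ((natHomπ ψ F).restrict (λ_ _).hom)
  have key : ∀ {X Y : V} (f : Y ⟶ (EnrichedCategory.Hom X (natHom ψ F) : V)),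
      ((coneComparison μ X).restrict f).comp (evFam F X) =
        (natHomπ ψ F).restrict (f ▷ X ≫ (β_ _ _).hom ≫ vev X _) := by
    intro X Y f
    ext j
    have hj : gcomp (μ.app j) (evAt (natHom ψ F) (F.obj j)) =
      (λ_ _).hom ≫ (natHomπ ψ F).app j := congrArg (fun γ => NatFam.app γ j) hμ
    exact key_aux f (μ.app j) ((natHomπ ψ F).app j) hj
  refine ⟨μ, fun X Y α => ?_⟩
  obtain ⟨g, hg, hg'⟩ := isNatHom_natHomπ ψ F _ (α.comp (evFam F X))
  obtain ⟨f, rfl⟩ := (comp_vev_bijective X Y (natHom ψ F)).2 g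
  refine ⟨f, ?_, fun f' hf' => ?_⟩
  · apply (comp_evFam_bijective ψ F X Y).1
    exact (key f).trans hg
  · apply (comp_vev_bijective X Y (natHom ψ F)).1
    refine hg' _ ?_
    rw [← hf']
    exact (key f').symm

end WeightedLimits

section Classes
variable {V : Type u} [Category.{v} V] [MonoidalCategory V] [SymmetricCategory V]
  [MonoidalClosed V] [HasLimits V]

/-- The limit functor `{ψ, -} : [J, V] → V` of a weight `ψ : J → V`, namely the representable
functor `[J, V](ψ, -)`. By `isWeightedLimit_natHom` its value at `F` is the limit `{ψ, F}`. -/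
def weightedLimitFunctor {J : Type w} [EnrichedCategory V J] [IsSmallVCat V J]
    (ψ : EnrichedFunctor V J V) : EnrichedFunctor V (EnrichedFunctor V J V) V :=
  hom ψ

variable (V) in
/-- A weight: a presheaf `Kᵒᵖ → V` on a small `V`-category `K`. -/
structure Weight where
  /-- The small `V`-category `K`. -/
  dom : Type w
  /-- The enrichment of `K` in `V`. -/
  [enrichment : EnrichedCategory V dom]
  [small : IsSmallVCat V dom]
  /-- The presheaf itself. -/
  presheaf : EnrichedFunctor V domᵒᵖ V

attribute [instance] Weight.enrichment Weight.small

/-- `φ`-colimits commute with `ψ`-limits in `V`: the functor `{ψ, -} : [Kᵒᵖ, V] → V` preserves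
`φ`-colimits. -/
def ColimitsCommuteWithLimits (φ ψ : Weight.{w} V) : Prop :=
  PreservesWeightedColimits φ.presheaf (weightedLimitFunctor ψ.presheaf)

/-- The class `Φ⁻` of all weights `ψ` such that `Φ`-colimits commute with `ψ`-limits in `V`. -/
def minusClass (Φ : Set (Weight.{w} V)) : Set (Weight.{w} V) :=
  {ψ | ∀ φ ∈ Φ, ColimitsCommuteWithLimits φ ψ}

/-- The objects of the full subcategory `A_Φ`, the `Φ`-atoms: those `a` for which the representable
`A(a, -) : A → V` preserves all `Φ`-colimits that exist in `A`. -/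
def atoms (Φ : Set (Weight.{w} V)) (A : Type u₁) [EnrichedCategory V A] : Set A :=
  {a | ∀ φ ∈ Φ, PreservesWeightedColimits φ.presheaf (hom (V := V) a)}

/-- The full subcategory of `A` on the objects in `P` is closed in `A` under any `Ψ`-colimits that
exist in `A`. -/
def IsClosedUnderColimits (Ψ : Set (Weight.{w} V)) {A : Type u₁} [EnrichedCategory V A]
    (P : Set A) : Prop :=
  ∀ ψ ∈ Ψ, ∀ (S : EnrichedFunctor V ψ.dom A), (∀ k, S.obj k ∈ P) →
    ∀ (c : A) (μ : NatFam (𝟙_ V) ψ.presheaf (homOver S c)),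
      IsWeightedColimit ψ.presheaf S c μ → c ∈ P

end Classes

end VCat

end

namespace VCat

section Composition
variable {V : Type u} [Category.{v} V] [MonoidalCategory V]
  {C : Type u₁} [EnrichedCategory V C] {D : Type u₂} [EnrichedCategory V D]

lemma eComp_gcomp_map (F : EnrichedFunctor V C D) {c : C} {d : D}
    (f : 𝟙_ V ⟶ (d ⟶[V] F.obj c)) (a b : C) :
    eComp V c a b ≫ (λ_ _).inv ≫ gcomp f (F.map c b) =
      gcomp ((λ_ _).inv ≫ gcomp f (F.map c a)) (F.map a b) := by
  have h : eComp V c a b ≫ F.map c b = gcomp (F.map c a) (F.map a b) := F.map_comp c a b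
  rw [← whiskerRight_gcomp, gcomp_assoc, ← h, ← whiskerLeft_gcomp]
  simp

end Composition

section SelfEnrichment
variable {V : Type u} [Category.{v} V] [MonoidalCategory V] [MonoidalClosed V]

lemma vcurry_postL {X P Q R : V} (f : P ⊗ X ⟶ Q) (s : Q ⟶ R) :
    vcurry f ≫ postL P (vcurry ((ρ_ Q).hom ≫ s)) = vcurry (f ≫ s) := by
  rw [comp_postL, gcomp_vcurry, comp_vcurry]
  simp

lemma vcurry_preR {X P Q R : V} (f : Q ⊗ X ⟶ R) (s : P ⟶ Q) :
    vcurry f ≫ preR (vcurry ((ρ_ P).hom ≫ s)) R = vcurry (s ▷ X ≫ f) := by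
  rw [comp_preR, gcomp_vcurry, comp_vcurry]
  simp

lemma inv_vcurry {P Q : V} (i : P ≅ Q) :
    Inv (vcurry ((ρ_ P).hom ≫ i.hom)) (vcurry ((ρ_ Q).hom ≫ i.inv)) where
  hom_inv := by rw [← comp_preR, vcurry_preR, eId_eq_vcurry]; simp
  inv_hom := by rw [← comp_preR, vcurry_preR, eId_eq_vcurry]; simp

end SelfEnrichment

section Uncurried
variable {V : Type u} [Category.{v} V] [MonoidalCategory V] [SymmetricCategory V]
  [MonoidalClosed V]
  {K : Type w} [EnrichedCategory V K] {A : Type u₁} [EnrichedCategory V A]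
  {B : Type u₂} [EnrichedCategory V B]

/-- The action `K(l, k) ⊗ φ k → φ l` of a presheaf. -/
def act (φ : EnrichedFunctor V Kᵒᵖ V) (l k : K) :
    (l ⟶[V] k) ⊗ φ.obj (op k) ⟶ φ.obj (op l) :=
  (β_ _ _).hom ≫ vcurry.symm (φ.map (op k) (op l))

/-- The families `t k : φ k ⊗ X → A(o k, a)` which are `V`-natural in `k`. -/
def IsCylinder (φ : EnrichedFunctor V Kᵒᵖ V) {o : K → A}
    (m : ∀ l k : K, (l ⟶[V] k) ⟶ (o l ⟶[V] o k)) {a : A} {X : V}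
    (t : ∀ k, φ.obj (op k) ⊗ X ⟶ (o k ⟶[V] a)) : Prop :=
  ∀ l k, act φ l k ▷ X ≫ t l = (α_ _ _ _).hom ≫ gcomp (m l k) (t k)

/-- The universal property of a weighted colimit in uncurried form: every natural family
`φ k ⊗ X → A(o k, a)` factors uniquely through `n k : φ k → A(o k, c)`. -/
def IsUniversalCylinder (φ : EnrichedFunctor V Kᵒᵖ V) {o : K → A}
    (m : ∀ l k : K, (l ⟶[V] k) ⟶ (o l ⟶[V] o k)) (c : A)
    (n : ∀ k, φ.obj (op k) ⟶ (o k ⟶[V] c)) : Prop :=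
  ∀ (a : A) (X : V) (t : ∀ k, φ.obj (op k) ⊗ X ⟶ (o k ⟶[V] a)), IsCylinder φ m t →
    ∃! f : X ⟶ (c ⟶[V] a), ∀ k, gcomp (n k) f = t k

/-- The uncurried components `φ k ⊗ X → A(S k, a)` of a family into `A(S-, a)`. -/
def uncurryApp {φ : EnrichedFunctor V Kᵒᵖ V} {S : EnrichedFunctor V K A} {a : A} {X : V}
    (α : NatFam X φ (homOver S a)) (k : K) : φ.obj (op k) ⊗ X ⟶ (S.obj k ⟶[V] a) :=
  vcurry.symm (α.app (op k))

lemma vcurry_uncurryApp {φ : EnrichedFunctor V Kᵒᵖ V} {S : EnrichedFunctor V K A} {a : A} {X : V}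
    (α : NatFam X φ (homOver S a)) (k : K) : vcurry (uncurryApp α k) = α.app (op k) :=
  Equiv.apply_symm_apply _ _

lemma uncurryApp_eq_iff {φ : EnrichedFunctor V Kᵒᵖ V} {S : EnrichedFunctor V K A} {a : A} {X : V}
    (α : NatFam X φ (homOver S a)) (k : K) (t : φ.obj (op k) ⊗ X ⟶ (S.obj k ⟶[V] a)) :
    uncurryApp α k = t ↔ α.app (op k) = vcurry t := by
  rw [← vcurry_uncurryApp]
  exact vcurry.injective.eq_iff.symm

/-- The components `φ k → A(S k, c)` of a cocone. -/
def coconeApp {φ : EnrichedFunctor V Kᵒᵖ V} {S : EnrichedFunctor V K A} {c : A}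
    (μ : NatFam (𝟙_ V) φ (homOver S c)) (k : K) : φ.obj (op k) ⟶ (S.obj k ⟶[V] c) :=
  (ρ_ _).inv ≫ uncurryApp μ k

lemma isCylinder_iff {φ : EnrichedFunctor V Kᵒᵖ V} {S : EnrichedFunctor V K A} {a : A} {X : V}
    (t : ∀ k, φ.obj (op k) ⊗ X ⟶ (S.obj k ⟶[V] a)) (l k : K) :
    ((β_ X (l ⟶[V] k)).hom ≫ gcomp (φ.map (op k) (op l)) (vcurry (t l)) =
      gcomp (vcurry (t k)) (precomp (S.map l k) a)) ↔
      act φ l k ▷ X ≫ t l = (α_ _ _ _).hom ≫ gcomp (S.map l k) (t k) := by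
  obtain ⟨b, hb⟩ : ∃ b : φ.obj (op k) ⊗ (l ⟶[V] k) ⟶ φ.obj (op l),
    vcurry b = φ.map (op k) (op l) := vcurry.surjective _
  have hact : act φ l k = (β_ _ _).hom ≫ b := by
    rw [act, ← hb]
    exact congrArg (_ ≫ ·) (vcurry.symm_apply_apply b)
  have h1 : gcomp (φ.map (op k) (op l)) (vcurry (t l)) =
    vcurry ((α_ _ _ _).inv ≫ b ▷ X ≫ t l) := by rw [← gcomp_vcurry, hb]
  rw [hact, h1, precomp_eq, gcomp_vcurry, comp_vcurry,
    BraidedCategory.braiding_naturality_left_assoc, whiskerLeft_gcomp, Category.comp_id,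
    BraidedCategory.braiding_tensor_left_hom, vcurry.injective.eq_iff]
  simp only [Category.assoc, Iso.inv_hom_id_assoc, comp_whiskerRight]
  rw [cancel_epi, cancel_epi, ← cancel_epi ((β_ (l ⟶[V] k) (φ.obj (op k))).hom ▷ X),
    ← comp_whiskerRight_assoc _ (β_ (φ.obj (op k)) (l ⟶[V] k)).hom, SymmetricCategory.symmetry]
  simp

lemma cocomparison_restrict_app {φ : EnrichedFunctor V Kᵒᵖ V} {S : EnrichedFunctor V K A} {c a : A}
    (μ : NatFam (𝟙_ V) φ (homOver S c)) {X : V} (f : X ⟶ (c ⟶[V] a)) (k : K) :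
    uncurryApp ((cocomparison μ a).restrict f) k = gcomp (coconeApp μ k) f := by
  rw [uncurryApp_eq_iff]
  have h : gcomp (μ.app (op k)) (vcurry (eComp V (S.obj k) c a)) =
      vcurry ((α_ _ _ _).inv ≫ uncurryApp μ k ▷ _ ≫ eComp V (S.obj k) c a) := by
    rw [← gcomp_vcurry, vcurry_uncurryApp]
    rfl
  change f ≫ (λ_ _).inv ≫ gcomp (μ.app (op k)) (vcurry (eComp V (S.obj k) c a)) = _
  rw [h, comp_vcurry, comp_vcurry, coconeApp, gcomp, MonoidalCategory.tensorHom_def']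
  simp

theorem isWeightedColimit_iff {φ : EnrichedFunctor V Kᵒᵖ V} {S : EnrichedFunctor V K A} {c : A}
    (μ : NatFam (𝟙_ V) φ (homOver S c)) :
    IsWeightedColimit φ S c μ ↔ IsUniversalCylinder φ S.map c (coconeApp μ) := by
  have key : ∀ {a : A} {X : V} (f : X ⟶ (c ⟶[V] a)) (α : NatFam X φ (homOver S a)),
      (cocomparison μ a).restrict f = α ↔
        ∀ k, gcomp (coconeApp μ k) f = uncurryApp α k := by
    intro a X f α
    simp only [← cocomparison_restrict_app]
    refine ⟨fun h k => by rw [h], fun h => NatFam.ext (funext fun k => ?_)⟩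
    exact vcurry.symm.injective (h k.unop)
  constructor
  · intro h a X t ht
    let α : NatFam X φ (homOver S a) :=
      NatFam.mk (fun k => vcurry (t k.unop)) fun x y => (isCylinder_iff t y.unop x.unop).2 (ht _ _)
    have hα : ∀ k, uncurryApp α k = t k := fun k => (uncurryApp_eq_iff _ _ _).2 rfl
    have := h a X α
    simpa only [key, hα] using this
  · intro h a X α
    simp only [key]
    refine h a X (uncurryApp α) fun l k => ?_
    rw [← isCylinder_iff, vcurry_uncurryApp, vcurry_uncurryApp]
    exact α.nat (op k) (op l)

lemma coconeApp_mapCocone (F : EnrichedFunctor V A B) {φ : EnrichedFunctor V Kᵒᵖ V}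
    {S : EnrichedFunctor V K A} {c : A} (μ : NatFam (𝟙_ V) φ (homOver S c)) (k : K) :
    coconeApp (mapCocone F μ) k = coconeApp μ k ≫ F.map (S.obj k) c := by
  have h : uncurryApp (mapCocone F μ) k =
      uncurryApp μ k ≫ F.map (S.obj k) c := by
    refine (uncurryApp_eq_iff (mapCocone F μ) k _).2 ?_
    change (λ_ _).inv ≫ gcomp (μ.app (op k)) (vcurry ((ρ_ _).hom ≫ F.map (S.obj k) c)) = _
    have h' : gcomp (μ.app (op k)) (vcurry ((ρ_ (S.obj k ⟶[V] c)).hom ≫ F.map (S.obj k) c)) =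
        vcurry ((α_ _ _ _).inv ≫ uncurryApp μ k ▷ _ ≫ (ρ_ _).hom ≫ F.map (S.obj k) c) := by
      rw [← gcomp_vcurry, vcurry_uncurryApp]
      rfl
    refine (congrArg ((λ_ _).inv ≫ ·) h').trans ?_
    rw [comp_vcurry]
    congr 1
    rw [rightUnitor_naturality_assoc, rightUnitor_tensor_hom_assoc, Iso.inv_hom_id_assoc,
      ← MonoidalCategory.whiskerLeft_comp_assoc, unitors_equal.symm, Iso.inv_hom_id]
    simp
  rw [coconeApp, coconeApp, Category.assoc]
  exact congrArg ((ρ_ _).inv ≫ ·) h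

/-- Preservation of weighted colimits in terms of uncurried universal properties. -/
theorem preservesWeightedColimits_iff (φ : EnrichedFunctor V Kᵒᵖ V) (F : EnrichedFunctor V A B) :
    PreservesWeightedColimits φ F ↔
      ∀ (S : EnrichedFunctor V K A) (c : A) (μ : NatFam (𝟙_ V) φ (homOver S c)),
        IsWeightedColimit φ S c μ →
          IsUniversalCylinder φ (o := fun k => F.obj (S.obj k))
            (fun l k => S.map l k ≫ F.map _ _) (F.obj c)
            (fun k => coconeApp μ k ≫ F.map (S.obj k) c) := by
  refine forall_congr' fun S => forall_congr' fun c => forall_congr' fun μ =>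
    forall_congr' fun _ => ?_
  rw [isWeightedColimit_iff, funext (coconeApp_mapCocone F μ)]
  exact Iff.of_eq (by congr)

lemma IsUniversalCylinder.congr {φ : EnrichedFunctor V Kᵒᵖ V} {o : K → A}
    {m m' : ∀ l k : K, (l ⟶[V] k) ⟶ (o l ⟶[V] o k)} {c : A}
    {n n' : ∀ k, φ.obj (op k) ⟶ (o k ⟶[V] c)} (h : IsUniversalCylinder φ m c n)
    (hm : ∀ l k, m' l k = m l k) (hn : ∀ k, n' k = n k) : IsUniversalCylinder φ m' c n' := by
  rwa [funext hn, funext fun l => funext (hm l)]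

/-- The uncurried universal property is invariant under natural isomorphism. -/
lemma IsUniversalCylinder.of_iso {φ : EnrichedFunctor V Kᵒᵖ V} {o o' : K → A}
    {m : ∀ l k : K, (l ⟶[V] k) ⟶ (o l ⟶[V] o k)} {m' : ∀ l k : K, (l ⟶[V] k) ⟶ (o' l ⟶[V] o' k)}
    {c c' : A} {n : ∀ k, φ.obj (op k) ⟶ (o k ⟶[V] c)} {n' : ∀ k, φ.obj (op k) ⟶ (o' k ⟶[V] c')}
    (h : IsUniversalCylinder φ m c n)
    {g : ∀ k, 𝟙_ V ⟶ (o k ⟶[V] o' k)} {g' : ∀ k, 𝟙_ V ⟶ (o' k ⟶[V] o k)}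
    (hg : ∀ k, Inv (g k) (g' k)) {e : 𝟙_ V ⟶ (c ⟶[V] c')} {e' : 𝟙_ V ⟶ (c' ⟶[V] c)}
    (he : Inv e e') (hm : ∀ l k, m l k ≫ postL _ (g k) = m' l k ≫ preR (g l) _)
    (hn : ∀ k, n k ≫ postL _ e = n' k ≫ preR (g k) _) :
    IsUniversalCylinder φ m' c' n' := by
  intro a X t ht
  have key : ∀ (f : X ⟶ (c' ⟶[V] a)) (k : K),
      gcomp (n k) (f ≫ preR e a) = gcomp (n' k) f ≫ preR (g k) a := by
    intro f k
    rw [← gcomp_mid, hn, gcomp_preR]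
  obtain ⟨f, hf, hf'⟩ := h a X (fun k => t k ≫ preR (g k) a) (by
    intro l k
    rw [← Category.assoc, ht, Category.assoc, ← gcomp_preR, ← hm, gcomp_mid])
  have hinj : ∀ k, Function.Injective
      (fun s : φ.obj (op k) ⊗ X ⟶ (o' k ⟶[V] a) => s ≫ preR (g k) a) := by
    intro k s s' hs
    have := congrArg (fun r => r ≫ preR (g' k) a) hs
    simpa only [Category.assoc, (hg k).preR_preR, Category.comp_id] using this
  refine ⟨f ≫ preR e' a, fun k => hinj k ?_, fun f₂ hf₂ => ?_⟩
  · dsimp only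
    rw [← key, Category.assoc, he.symm.preR_preR, Category.comp_id, hf]
  · have := hf' (f₂ ≫ preR e a) fun k => by rw [key, hf₂]
    rw [← this, Category.assoc, he.preR_preR, Category.comp_id]

end Uncurried

section Functors
variable {V : Type u} [Category.{v} V] [MonoidalCategory V] [SymmetricCategory V]
  [MonoidalClosed V] [HasLimits V]
  {K : Type w} [EnrichedCategory V K] {A : Type u₁} [EnrichedCategory V A]

/-- Colimits in a functor category which are computed pointwise. -/
theorem isUniversalCylinder_of_pointwise {C : Type u₂} [EnrichedCategory V C] [IsSmallVCat V C]
    {D : Type u₃} [EnrichedCategory V D] {φ : EnrichedFunctor V Kᵒᵖ V}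
    {o : K → EnrichedFunctor V C D} {m : ∀ l k : K, (l ⟶[V] k) ⟶ (o l ⟶[V] o k)}
    {F : EnrichedFunctor V C D} {n : ∀ k, φ.obj (op k) ⟶ (o k ⟶[V] F)}
    (h : ∀ x, IsUniversalCylinder φ (o := fun k => (o k).obj x)
      (fun l k => m l k ≫ (natHomπ (o l) (o k)).app x) (F.obj x)
      (fun k => n k ≫ (natHomπ (o k) F).app x)) :
    IsUniversalCylinder φ m F n := by
  have hπ : ∀ {G₁ G₂ G₃ : EnrichedFunctor V C D} {X Y : V} (f : X ⟶ (G₁ ⟶[V] G₂))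
      (g : Y ⟶ (G₂ ⟶[V] G₃)) (x : C), gcomp f g ≫ (natHomπ G₁ G₃).app x =
        gcomp (f ≫ (natHomπ G₁ G₂).app x) (g ≫ (natHomπ G₂ G₃).app x) := by
    intro G₁ G₂ G₃ X Y f g x
    have : eComp V G₁ G₂ G₃ = natHomLift ((natHomπ G₁ G₂).comp (natHomπ G₂ G₃)) := rfl
    rw [gcomp, this, Category.assoc, natHomLift_app]
    exact tensor_gcomp _ _ _ _
  intro G X t ht
  have htx : ∀ x, IsCylinder φ (o := fun k => (o k).obj x)
      (fun l k => m l k ≫ (natHomπ (o l) (o k)).app x)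
      (fun k => t k ≫ (natHomπ (o k) G).app x) := by
    intro x l k
    rw [← hπ, ← Category.assoc, ht, Category.assoc]
  choose f hf hf' using fun x => h x (G.obj x) X _ (htx x)
  have hnat : ∀ x y : C, (β_ X (x ⟶[V] y)).hom ≫ gcomp (F.map x y) (f y) =
      gcomp (f x) (G.map x y) := by
    intro x y
    -- both sides factor the same cylinder with vertex `X ⊗ C(x, y)`
    let s : ∀ k, φ.obj (op k) ⊗ (X ⊗ (x ⟶[V] y)) ⟶ ((o k).obj x ⟶[V] G.obj y) := fun k =>
      (α_ _ _ _).inv ≫ gcomp (t k ≫ (natHomπ (o k) G).app x) (G.map x y)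
    have hs : ∀ k, s k =
        (α_ _ _ _).inv ≫ gcomp (t k ≫ (natHomπ (o k) G).app x) (G.map x y) := fun _ => rfl
    refine (h x (G.obj y) (X ⊗ (x ⟶[V] y)) s ?_).unique (fun k => ?_) (fun k => ?_)
    · intro l k
      have e := htx x l k
      dsimp only at e
      rw [hs, hs, associator_inv_naturality_left_assoc, whiskerRight_gcomp, e,
        ← whiskerRight_gcomp, gcomp_assoc, ← whiskerLeft_gcomp]
      simp
    · have e1 := ((natHomπ (o k) G).restrict (t k)).nat x y
      have e2 := ((natHomπ (o k) F).restrict (n k)).nat x y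
      simp only [NatFam.restrict] at e1 e2
      rw [hs, ← e1, ← hf y k, BraidedCategory.braiding_tensor_left_hom]
      have e3 := gcomp_assoc ((o k).map x y) (n k ≫ (natHomπ (o k) F).app y) (f y)
      rw [← Iso.inv_comp_eq] at e3
      simp only [Category.assoc, Iso.inv_hom_id_assoc]
      rw [← e3, Iso.hom_inv_id_assoc, whiskerRight_gcomp, e2, gcomp_assoc, Iso.inv_hom_id_assoc,
        whiskerLeft_gcomp]
    · rw [hs, ← hf x k, gcomp_assoc, Iso.inv_hom_id_assoc]
  refine ⟨natHomLift ⟨f, hnat⟩, fun k => natHom_ext fun x => ?_, fun g hg => natHom_ext fun x => ?_⟩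
  · rw [hπ, natHomLift_app]
    exact hf x k
  · rw [natHomLift_app]
    refine hf' x _ fun k => ?_
    rw [← hπ, hg]

/-- The functor `a ↦ A(S-, a)`. -/
noncomputable def restrictedYoneda [IsSmallVCat V K] (S : EnrichedFunctor V K A) :
    EnrichedFunctor V A (EnrichedFunctor V Kᵒᵖ V) where
  obj a := homOver S a
  map a b := natHomLift (push S a b)
  map_id a := by
    refine natHom_ext fun k => ?_
    have : eId V (homOver S a) = natHomLift (NatFam.ident (homOver S a)) := rfl
    rw [this, Category.assoc, natHomLift_app, natHomLift_app]
    exact (hom (S.obj k.unop)).map_id a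
  map_comp a b c := by
    refine natHom_ext fun k => ?_
    have : eComp V (homOver S a) (homOver S b) (homOver S c) =
      natHomLift ((natHomπ _ _).comp (natHomπ _ _)) := rfl
    rw [this, Category.assoc, Category.assoc, natHomLift_app, natHomLift_app]
    refine ((hom (S.obj k.unop)).map_comp a b c).trans ?_
    refine Eq.trans ?_ (tensor_gcomp _ _ _ _).symm
    exact (congrArg₂ gcomp (natHomLift_app (push S a b) k) (natHomLift_app (push S b c) k)).symm

/-- The functor `a ↦ A(S-, a)` preserves the colimits preserved by each `A(S j, -)`. -/
theorem restrictedYoneda_preservesWeightedColimits {J : Type w} [EnrichedCategory V J]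
    [IsSmallVCat V J] (S : EnrichedFunctor V J A) (φ : EnrichedFunctor V Kᵒᵖ V)
    (hS : ∀ j, PreservesWeightedColimits φ (hom (V := V) (S.obj j))) :
    PreservesWeightedColimits φ (restrictedYoneda S) := by
  rw [preservesWeightedColimits_iff]
  intro T d ν hν
  refine isUniversalCylinder_of_pointwise fun x => ?_
  have h := (preservesWeightedColimits_iff _ _).1 (hS x.unop) T d ν hν
  have hx : ∀ a b, (restrictedYoneda S).map a b ≫ (natHomπ (homOver S a) (homOver S b)).app x =
      (hom (S.obj x.unop)).map a b := fun a b => natHomLift_app (push S a b) x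
  refine h.congr (fun l k => ?_) fun k => ?_
  · exact (Category.assoc _ _ _).trans (congrArg (T.map l k ≫ ·) (hx _ _))
  · exact (Category.assoc _ _ _).trans (congrArg (coconeApp ν k ≫ ·) (hx _ _))

lemma isIso_natHomLift {C : Type u₂} [EnrichedCategory V C] [IsSmallVCat V C]
    {D : Type u₃} [EnrichedCategory V D] {F G : EnrichedFunctor V C D} {E : V}
    {π : NatFam E F G} (h : IsNatHom π) : IsIso (natHomLift π) := by
  obtain ⟨r, hr, -⟩ := h _ (natHomπ F G)
  have hr' : ∀ c, r ≫ π.app c = (natHomπ F G).app c :=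
    fun c => congrArg (fun γ => NatFam.app γ c) hr
  refine ⟨r, (h E π).unique (NatFam.ext (funext fun c => ?_))
    (NatFam.ext (funext fun c => Category.id_comp _)), natHom_ext fun c => ?_⟩
  · change (natHomLift π ≫ r) ≫ π.app c = π.app c
    rw [Category.assoc, hr', natHomLift_app]
  · rw [Category.assoc, natHomLift_app, hr', Category.id_comp]

/-- The comparisons `A(c, a) → [Kᵒᵖ, V](ψ, A(S-, a))` are `V`-natural in `a`. -/
lemma natHomLift_cocomparison_natural [IsSmallVCat V K] {ψ : EnrichedFunctor V Kᵒᵖ V}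
    {S : EnrichedFunctor V K A} {c : A} (μ : NatFam (𝟙_ V) ψ (homOver S c)) (a b : A) :
    eComp V c a b ≫ natHomLift (cocomparison μ b) =
      natHomLift (cocomparison μ a) ▷ _ ≫ (_ ◁ (restrictedYoneda S).map a b) ≫
        eComp V ψ (homOver S a) (homOver S b) := by
  have hc : eComp V ψ (homOver S a) (homOver S b) =
    natHomLift ((natHomπ _ _).comp (natHomπ _ _)) := rfl
  refine natHom_ext fun k => ?_
  rw [hc]
  simp only [Category.assoc, natHomLift_app]
  have h1 : natHomLift (cocomparison μ a) ▷ _ ≫ _ ◁ (restrictedYoneda S).map a b ≫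
      ((natHomπ ψ (homOver S a)).comp (natHomπ (homOver S a) (homOver S b))).app k =
      gcomp ((λ_ _).inv ≫ gcomp (μ.app k) ((hom (S.obj k.unop)).map c a))
        ((hom (S.obj k.unop)).map a b) := by
    refine (congrArg (_ ≫ ·) (whiskerLeft_gcomp _ _ _)).trans ?_
    refine (whiskerRight_gcomp _ _ _).trans ?_
    exact congrArg₂ gcomp (natHomLift_app (cocomparison μ a) k) (natHomLift_app (push S a b) k)
  have h2 : (natHomLift (cocomparison μ a) ▷ _ ≫ (_ ◁ (restrictedYoneda S).map a b ≫
      natHomLift ((natHomπ ψ (homOver S a)).comp (natHomπ (homOver S a) (homOver S b)))) ≫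
        (natHomπ ψ (homOver S b)).app k) =
      natHomLift (cocomparison μ a) ▷ _ ≫ _ ◁ (restrictedYoneda S).map a b ≫
      ((natHomπ ψ (homOver S a)).comp (natHomπ (homOver S a) (homOver S b))).app k := by
    refine congrArg (_ ≫ ·) ((Category.assoc _ _ _).trans ?_)
    exact congrArg (_ ≫ ·) (natHomLift_app _ k)
  refine Eq.trans ?_ (h2.trans h1).symm
  change eComp V c a b ≫ (λ_ _).inv ≫ gcomp (μ.app k) ((hom (S.obj k.unop)).map c b) = _
  exact eComp_gcomp_map (hom (S.obj k.unop)) (μ.app k) a b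

end Functors

end VCat

open VCat in
theorem proposition5p2 {V : Type u} [Category.{v} V] [MonoidalCategory V] [SymmetricCategory V]
    [MonoidalClosed V] [HasLimits V] [HasColimits V] (Φ : Set (VCat.Weight.{w} V))
    (A : Type u₁) [EnrichedCategory V A] :
    VCat.IsClosedUnderColimits (VCat.minusClass Φ) (VCat.atoms Φ A) := by
  intro ψ hψ S hS c μ hμ φ hφ
  rw [preservesWeightedColimits_iff]
  intro T d ν hν
  have hY := restrictedYoneda_preservesWeightedColimits S φ.presheaf (fun j => hS j φ hφ) T d ν hν
  have h := (preservesWeightedColimits_iff _ _).1 (hψ φ hφ) _ _ _ hY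
  let i : ∀ a, (c ⟶[V] a) ≅ natHom ψ.presheaf (homOver S a) := fun a =>
    have := isIso_natHomLift (hμ a)
    asIso (natHomLift (cocomparison μ a))
  have hnat : ∀ a b, ((restrictedYoneda S).map a b ≫
      (weightedLimitFunctor ψ.presheaf).map (homOver S a) (homOver S b)) ≫
        postL _ (vcurry ((ρ_ _).hom ≫ (i b).inv)) =
      (hom c).map a b ≫ preR (vcurry ((ρ_ _).hom ≫ (i a).inv)) _ := by
    intro a b
    have h1 : (restrictedYoneda S).map a b ≫
        (weightedLimitFunctor ψ.presheaf).map (homOver S a) (homOver S b) =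
        vcurry (_ ◁ (restrictedYoneda S).map a b ≫ eComp V ψ.presheaf (homOver S a) (homOver S b)) :=
      comp_vcurry _ _
    refine (congrArg (· ≫ _) h1).trans ((vcurry_postL _ _).trans ?_)
    refine Eq.trans (congrArg vcurry ?_) (vcurry_preR _ _).symm
    refine ((i b).comp_inv_eq).2 (Eq.symm ?_)
    refine (Category.assoc _ _ _).trans
      ((congrArg (_ ≫ ·) (natHomLift_cocomparison_natural μ a b)).trans ?_)
    exact (Iso.inv_hom_id_assoc (whiskerRightIso (i a) _) _)
  refine h.of_iso (fun k => (inv_vcurry (i (T.obj k))).symm) (inv_vcurry (i d)).symm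
    (fun l k => ?_) fun k => ?_
  · refine Eq.trans ?_ ((congrArg (T.map l k ≫ ·) (hnat (T.obj l) (T.obj k))).trans
      (Category.assoc _ _ _).symm)
    refine Eq.trans ?_ (Category.assoc _ _ _)
    exact congrArg (· ≫ _) (Category.assoc _ _ _)
  · refine Eq.trans ?_ ((congrArg (coconeApp ν k ≫ ·) (hnat (T.obj k) d)).trans
      (Category.assoc _ _ _).symm)
    refine Eq.trans ?_ (Category.assoc _ _ _)
    refine congrArg (· ≫ _) (Eq.trans ?_ (Category.assoc _ _ _))
    exact congrArg (· ≫ _) (coconeApp_mapCocone (restrictedYoneda S) ν k)
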